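/- Let $m_1,m_2,\dots$ be integers with $m_i\ge 2$, let $Y_i=\{1,\dots,m_i\}$, and let $\mathcal T$ be the rooted tree whose vertices are the finite words $y_1y_2\cdots y_k$ with $y_i\in Y_i$, ordered by the prefix relation; for $r\ge 0$ let $\mathcal T_r$ be the tree built in the same way from $Y_{r+1},Y_{r+2},\dots$. A defining triple $\omega=(A_\omega,B,\overline\omega)$ consists of a group $A_\omega\le \mathrm{Sym}(Y_1)$, a group $B$, and homomorphisms $\omega_{i,j}:B\to \mathrm{Sym}(Y_{i+1})$ for $i\ge 1$ and $1\le j\le m_i-1$. A permutation $a$ of $Y_{r+1}$ acts on $\mathcal T_r$ as a rooted automorphism, by changing only the first letter of a word. Each $b\in B$ defines directed automorphisms $b_{\sigma^r\omega}$ of $\mathcal T_r$ ($r\ge 0$), determined by the following: $b_{\sigma^r\omega}$ fixes the first level, its section at the letter $j\le m_{r+1}-1$ is the rooted automorphism $\omega_{r+1,j}(b)$, and its section at the letter $m_{r+1}$ is $b_{\sigma^{r+1}\omega}$. Put $b_\omega=b_{\sigma^0\omega}$, $B_\omega=\{b_\omega: b\in B\}$ and $$G_\omega=\langle A_\omega\cup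 B_\omega\rangle\le \mathrm{Aut}(\mathcal T).$$ Put $A_{\sigma^0\omega}=A_\omega$ and, for $r\ge 1$, $A_{\sigma^r\omega}=\big\langle \bigcup_{j=1}^{m_r-1}\omega_{r,j}(B)\big\rangle\le \mathrm{Sym}(Y_{r+1})$. The group $G_\omega$ is called a GG group, with directed part $B$, if 1. $A_{\sigma^r\omega}$ acts transitively on $Y_{r+1}$ for every $r\ge 0$; 2. $\bigcap_{i\ge r}\bigcap_{j=1}^{m_i-1}\ker\omega_{i,j}=1$ for every $r\ge 1$ (strong kernel intersection condition); 3. $\omega_{i,j}$ is trivial whenever $j\neq 1$; 4. $\bigcup_{i\ge r}\ker\omega_{i,1}=B$ for every $r\ge 1$ (strong covering condition). **Theorem.** A GG group $G_\omega$ is a torsion group if and only if its directed part $B$ is a torsion group. -/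

import Mathlib

/-- `Word m n` is the vertex set of the spherically homogeneous rooted tree `𝒯ₙ` whose vertices are
the finite words `y₀ y₁ ⋯ y_{k-1}` with `yᵢ` in the alphabet `Fin (m (n + i))`.
Thus `Word m 0` is the tree with branching indices `m 0, m 1, m 2, …`, and `Word m n` is the
tree with the branching indices shifted `n` times. -/
inductive Word (m : ℕ → ℕ) : ℕ → Type
  | nil {n : ℕ} : Word m n
  | cons {n : ℕ} (y : Fin (m n)) (w : Word m (n + 1)) : Word m n

namespace Word

variable {m : ℕ → ℕ}

/-- The prefix relation on words. -/
def IsPrefix : {n : ℕ} → Word m n → Word m n → Prop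
  | _, nil, _ => True
  | _, cons _ _, nil => False
  | _, cons y u, cons z v => y = z ∧ IsPrefix u v

instance (n : ℕ) : LE (Word m n) := ⟨IsPrefix⟩

end Word

/-- The automorphism group of the tree `𝒯ₙ`: the permutations of the words that preserve (and
reflect) the prefix relation. -/
abbrev TreeAut (m : ℕ → ℕ) (n : ℕ) : Type := Word m n ≃o Word m n

namespace Word

variable {m : ℕ → ℕ}

/-- Apply a permutation of the first alphabet to the first letter of a word. -/
def rootedFun {n : ℕ} (a : Equiv.Perm (Fin (m n))) : Word m n → Word m n
  | nil => nil
  | cons y w => cons (a y) w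

theorem rootedFun_mul {n : ℕ} (a b : Equiv.Perm (Fin (m n))) (w : Word m n) :
    rootedFun (a * b) w = rootedFun a (rootedFun b w) := by
  cases w <;> rfl

theorem rootedFun_one {n : ℕ} (w : Word m n) :
    rootedFun (1 : Equiv.Perm (Fin (m n))) w = w := by
  cases w <;> rfl

theorem rootedFun_le {n : ℕ} (a : Equiv.Perm (Fin (m n))) (u v : Word m n) :
    rootedFun a u ≤ rootedFun a v ↔ u ≤ v := by
  change IsPrefix _ _ ↔ IsPrefix _ _
  cases u <;> cases v <;> simp [rootedFun, IsPrefix]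

/-- The rooted automorphism of `𝒯ₙ` defined by a permutation of the first alphabet. -/
def rooted (m : ℕ → ℕ) (n : ℕ) : Equiv.Perm (Fin (m n)) →* TreeAut m n where
  toFun a :=
    { toFun := rootedFun a
      invFun := rootedFun a⁻¹
      left_inv := fun w => by rw [← rootedFun_mul, inv_mul_cancel, rootedFun_one]
      right_inv := fun w => by rw [← rootedFun_mul, mul_inv_cancel, rootedFun_one]
      map_rel_iff' := rootedFun_le a _ _ }
  map_one' := by ext w; exact rootedFun_one w
  map_mul' a b := by ext w; exact rootedFun_mul a b w

end Word

/-- A defining triple `ω = (A, B, (ω_{n,j}))` over the tree with branching indices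
`m 0, m 1, …`, all at least `2`: a group `A` of permutations of the first alphabet (equivalently,
of rooted automorphisms), a group `B`, and homomorphisms `ω_{n,j} : B → Sym(Fin (m (n + 1)))`,
one for each level `n` and each letter `j` of `Fin (m n)` other than the last letter `m n - 1`. -/
structure DefiningTriple (m : ℕ → ℕ) (B : Type*) [Group B] where
  two_le : ∀ n, 2 ≤ m n
  A : Subgroup (Equiv.Perm (Fin (m 0)))
  ω : ∀ n : ℕ, Fin (m n - 1) → B →* Equiv.Perm (Fin (m (n + 1)))

namespace DefiningTriple

variable {m : ℕ → ℕ} {B : Type*} [Group B] (T : DefiningTriple m B)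

open Word

/-- The action of `b ∈ B` on `𝒯ₙ`: the section at a letter `j` other than the last one is
the rooted automorphism `ω_{n,j}(b)`, the section at the last letter is the action of `b`
on `𝒯ₙ₊₁`, and the first level is fixed. -/
def directedFun (b : B) : {n : ℕ} → Word m n → Word m n
  | _, nil => nil
  | n, cons y w =>
      if h : (y : ℕ) < m n - 1 then cons y (rootedFun (T.ω n ⟨y, h⟩ b) w)
      else cons y (directedFun b w)

theorem directedFun_mul (b c : B) {n : ℕ} (w : Word m n) :
    T.directedFun (b * c) w = T.directedFun b (T.directedFun c w) := by
  induction w with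
  | nil => rfl
  | @cons n y w ih =>
    by_cases h : (y : ℕ) < m n - 1
    · simp [directedFun, h, rootedFun_mul]
    · simp [directedFun, h, ih]

theorem directedFun_one {n : ℕ} (w : Word m n) : T.directedFun 1 w = w := by
  induction w with
  | nil => rfl
  | @cons n y w ih =>
    by_cases h : (y : ℕ) < m n - 1
    · simp [directedFun, h, rootedFun_one]
    · simp [directedFun, h, ih]

theorem directedFun_le (b : B) {n : ℕ} (u v : Word m n) :
    T.directedFun b u ≤ T.directedFun b v ↔ u ≤ v := by
  change IsPrefix _ _ ↔ IsPrefix _ _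
  induction u with
  | nil => simp [directedFun, IsPrefix]
  | @cons n y u ih =>
    cases v with
    | nil => by_cases h : (y : ℕ) < m n - 1 <;> simp [directedFun, h, IsPrefix]
    | cons z v =>
      by_cases hyz : y = z
      · subst hyz
        by_cases h : (y : ℕ) < m n - 1
        · have key : IsPrefix _ _ ↔ IsPrefix _ _ := rootedFun_le (T.ω n ⟨y, h⟩ b) u v
          simpa [directedFun, h, IsPrefix] using key
        · simpa [directedFun, h, IsPrefix] using ih v
      · by_cases h : (y : ℕ) < m n - 1 <;> by_cases h' : (z : ℕ) < m n - 1 <;>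
          simp [directedFun, h, h', IsPrefix, hyz]

/-- The directed automorphism `b_{σⁿω}` of `𝒯ₙ` defined by `b ∈ B`. -/
def directed (n : ℕ) : B →* TreeAut m n where
  toFun b :=
    { toFun := T.directedFun b
      invFun := T.directedFun b⁻¹
      left_inv := fun w => by rw [← directedFun_mul, inv_mul_cancel, directedFun_one]
      right_inv := fun w => by rw [← directedFun_mul, mul_inv_cancel, directedFun_one]
      map_rel_iff' := T.directedFun_le b _ _ }
  map_one' := by ext w; exact T.directedFun_one w
  map_mul' b c := by ext w; exact T.directedFun_mul b c w

/-- The root group `A_{σʳω}` of the `r`-th shifted triple: it is `A` for `r = 0`, and for `r + 1`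
it is generated by the images of `B` under all the homomorphisms `ω_{r,j}`. -/
def rootGroup : (r : ℕ) → Subgroup (Equiv.Perm (Fin (m r)))
  | 0 => T.A
  | r + 1 => Subgroup.closure (⋃ j : Fin (m r - 1), Set.range (T.ω r j))

/-- The group `G_{σʳω}` of automorphisms of `𝒯ᵣ` generated by the rooted automorphisms
`A_{σʳω}` and the directed automorphisms `B_{σʳω}`. -/
def shiftedGroup (r : ℕ) : Subgroup (TreeAut m r) :=
  Subgroup.closure
    ((rooted m r '' (T.rootGroup r : Set (Equiv.Perm (Fin (m r))))) ∪ Set.range (T.directed r))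

/-- The group `G_ω = ⟨A_ω ∪ B_ω⟩` of automorphisms of the tree. -/
def G : Subgroup (TreeAut m 0) := T.shiftedGroup 0

/-- The triple defines a spinal group: spherical transitivity and strong kernel intersection. -/
structure IsSpinal : Prop where
  spherically_transitive : ∀ r, MulAction.IsPretransitive (T.rootGroup r) (Fin (m r))
  kernel_intersection : ∀ r, ⨅ n ≥ r, ⨅ j : Fin (m n - 1), (T.ω n j).ker = ⊥

/-- The index of the first letter. -/
def first (n : ℕ) : Fin (m n - 1) := ⟨0, Nat.sub_pos_of_lt (T.two_le n)⟩

/-- The kernel `Kₙ` of the homomorphism attached to the first letter on level `n`. -/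
def K (n : ℕ) : Subgroup B := (T.ω n (T.first n)).ker

/-- The triple defines a GG group: it defines a spinal group, only the homomorphisms attached to
first letters may be nontrivial, and their kernels satisfy the strong covering condition. -/
structure IsGG : Prop extends T.IsSpinal where
  trivial_of_ne_first : ∀ n, ∀ j : Fin (m n - 1), j ≠ T.first n → T.ω n j = 1
  strong_covering : ∀ r, ⋃ n ≥ r, (T.K n : Set B) = Set.univ

end DefiningTriple

/-! If `G` is torsion then so is `B`, because strong kernel intersection embeds `B` in `G`
(`directed_injective`). Conversely, induct on the number k of directed letters in a word
(`isOfFinOrder_eval`). Its order is finite if, for each first-level letter, the section of the power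
first returning there has finite order. A directed letter passes to one section only, so these
sections have at most k directed letters; fewer is the inductive case. Their rooted letters come
only from letters outside `K n`. By strong covering, some letter b of the word lies in some `K i`.
Descend to level i: unless directed letters are lost, b survives, and the next section has k
directed but fewer than k rooted letters. Then it is one element of `B`, or two directed letters are
cyclically adjacent and, after conjugation, merge. -/

namespace DefiningTriple

open Word

/-! ### Combinatorics of words -/

section Words

variable {α B : Type*}

/-- The directed letters of a word, with multiplicity. -/
def directedLetters (u : List (α ⊕ B)) : Multiset B :=
  ↑(u.filterMap Sum.getRight?)

/-- The number of rooted letters of a word. -/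
def rootedCount (u : List (α ⊕ B)) : ℕ := u.countP Sum.isLeft

theorem directedLetters_append (u v : List (α ⊕ B)) :
    directedLetters (u ++ v) = directedLetters u + directedLetters v := by
  simp [directedLetters]

theorem directedLetters_cons_inl (a : α) (u : List (α ⊕ B)) :
    directedLetters (.inl a :: u) = directedLetters u := rfl

theorem directedLetters_cons_inr (b : B) (u : List (α ⊕ B)) :
    directedLetters (.inr b :: u) = b ::ₘ directedLetters u := rfl

theorem rootedCount_append (u v : List (α ⊕ B)) :
    rootedCount (u ++ v) = rootedCount u + rootedCount v := by
  simp [rootedCount]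

theorem rootedCount_cons_inl (a : α) (u : List (α ⊕ B)) :
    rootedCount (.inl a :: u) = rootedCount u + 1 :=
  List.countP_cons_of_pos rfl

theorem rootedCount_cons_inr (b : B) (u : List (α ⊕ B)) :
    rootedCount (.inr b :: u) = rootedCount u :=
  List.countP_cons_of_neg (by simp)

/-- Without adjacent directed letters, each directed letter except a leading one is preceded by its
own rooted letter. -/
theorem exists_adjacent_inr_or (u : List (α ⊕ B)) :
    (∃ p b c q, u = p ++ .inr b :: .inr c :: q) ∨
      (directedLetters u).card ≤ rootedCount u ∨
      ((directedLetters u).card ≤ rootedCount u + 1 ∧ ∃ b v, u = .inr b :: v) := by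
  induction u with
  | nil => right; left; simp [directedLetters]
  | cons l u ih =>
    rcases ih with ⟨p, b, c, q, rfl⟩ | h | ⟨h, b, v, rfl⟩
    · exact .inl ⟨l :: p, b, c, q, rfl⟩
    · cases l with
      | inl a =>
        right; left
        rw [directedLetters_cons_inl, rootedCount_cons_inl]
        omega
      | inr b =>
        right; right
        rw [directedLetters_cons_inr, rootedCount_cons_inr, Multiset.card_cons]
        exact ⟨by omega, b, u, rfl⟩
    · cases l with
      | inl a =>
        right; left
        rw [directedLetters_cons_inl, rootedCount_cons_inl]
        exact h
      | inr c => exact .inl ⟨[], c, b, v, rfl⟩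

/-- If a word has fewer rooted than directed letters, then it is a single directed letter or two
directed letters are cyclically adjacent. -/
theorem exists_cyclically_adjacent_inr (u : List (α ⊕ B))
    (h : rootedCount u < (directedLetters u).card) :
    (∃ b, u = [.inr b]) ∨ (∃ p b c q, u = p ++ .inr b :: .inr c :: q) ∨
      ∃ d v p b c q, u = .inr d :: v ∧ v ++ [.inr d] = p ++ .inr b :: .inr c :: q := by
  rcases exists_adjacent_inr_or u with h1 | h1 | ⟨-, d, v, rfl⟩
  · exact .inr (.inl h1)
  · omega
  -- Rotating the leading letter to the end keeps both counts; if the rotated word also starts with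
  -- a directed letter, that letter followed `d` or is `d` itself.
  · rcases exists_adjacent_inr_or (v ++ [.inr d]) with ⟨p, b, c, q, h2⟩ | h2 | ⟨-, c, w, h2⟩
    · exact .inr (.inr ⟨d, v, p, b, c, q, rfl, h2⟩)
    · rw [directedLetters_append, rootedCount_append, directedLetters_cons_inr,
        rootedCount_cons_inr, Multiset.card_add, Multiset.card_cons,
        show directedLetters ([] : List (α ⊕ B)) = 0 from rfl, Multiset.card_zero,
        show rootedCount ([] : List (α ⊕ B)) = 0 from rfl] at h2
      rw [directedLetters_cons_inr, rootedCount_cons_inr, Multiset.card_cons] at h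
      omega
    · cases v with
      | nil => exact .inl ⟨d, rfl⟩
      | cons l v =>
        simp only [List.cons_append, List.cons.injEq] at h2
        exact .inr (.inl ⟨[], d, c, v, by rw [h2.1]; rfl⟩)

end Words

/-! ### Evaluation and sections -/

variable {m : ℕ → ℕ} {B : Type*} [Group B] (T : DefiningTriple m B)

/-- The element of the tree automorphism group spelled by a word in rooted and directed letters. -/
def eval (n : ℕ) (u : List (Equiv.Perm (Fin (m n)) ⊕ B)) : TreeAut m n :=
  (u.map (Sum.elim (rooted m n) (T.directed n))).prod

/-- The permutation of the first level induced by a word in rooted and directed letters. -/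
def topPerm {n : ℕ} (u : List (Equiv.Perm (Fin (m n)) ⊕ B)) : Equiv.Perm (Fin (m n)) :=
  (u.map (Sum.elim id fun _ => 1)).prod

/-- A word for the section of a letter at `y`. -/
def letterSection (n : ℕ) (y : Fin (m n)) :
    Equiv.Perm (Fin (m n)) ⊕ B → List (Equiv.Perm (Fin (m (n + 1))) ⊕ B)
  | .inl _ => []
  | .inr b =>
    if h : (y : ℕ) < m n - 1 then
      if T.ω n ⟨y, h⟩ b = 1 then [] else [.inl (T.ω n ⟨y, h⟩ b)]
    else [.inr b]

/-- A word for the section of a word at `y`. -/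
def wordSection (n : ℕ) (y : Fin (m n)) :
    List (Equiv.Perm (Fin (m n)) ⊕ B) → List (Equiv.Perm (Fin (m (n + 1))) ⊕ B)
  | [] => []
  | l :: u => T.letterSection n (topPerm u y) l ++ wordSection n y u

/-- A word for the section at `y` of the `k`-th power of a word. -/
def powSection (n : ℕ) (u : List (Equiv.Perm (Fin (m n)) ⊕ B)) (y : Fin (m n)) :
    ℕ → List (Equiv.Perm (Fin (m (n + 1))) ⊕ B)
  | 0 => []
  | k + 1 => T.wordSection n ((topPerm u)^[k] y) u ++ powSection n u y k

theorem eval_append (n : ℕ) (u v : List (Equiv.Perm (Fin (m n)) ⊕ B)) :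
    T.eval n (u ++ v) = T.eval n u * T.eval n v := by
  simp [eval]

theorem eval_cons (n : ℕ) (l : Equiv.Perm (Fin (m n)) ⊕ B)
    (u : List (Equiv.Perm (Fin (m n)) ⊕ B)) :
    T.eval n (l :: u) = T.eval n [l] * T.eval n u := by
  simp [eval]

theorem eval_nil (n : ℕ) : T.eval n [] = 1 := rfl

theorem eval_inl (n : ℕ) (a : Equiv.Perm (Fin (m n))) : T.eval n [.inl a] = rooted m n a := by
  simp [eval]

theorem eval_inr (n : ℕ) (b : B) : T.eval n [.inr b] = T.directed n b := by
  simp [eval]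

theorem eval_apply_nil (n : ℕ) (u : List (Equiv.Perm (Fin (m n)) ⊕ B)) :
    T.eval n u nil = nil := by
  induction u with
  | nil => rfl
  | cons l u ih =>
    rw [eval_cons, RelIso.mul_apply, ih]
    cases l with
    | inl a => rw [eval_inl]; rfl
    | inr b => rw [eval_inr]; rfl

theorem eval_letter_apply_cons (n : ℕ) (l : Equiv.Perm (Fin (m n)) ⊕ B) (y : Fin (m n))
    (w : Word m (n + 1)) :
    T.eval n [l] (cons y w) = cons (topPerm [l] y) (T.eval (n + 1) (T.letterSection n y l) w) := by
  cases l with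
  | inl a => rw [eval_inl]; simp [topPerm, letterSection, eval_nil]; rfl
  | inr b =>
    rw [eval_inr]
    change T.directedFun b (cons y w) = _
    by_cases h : (y : ℕ) < m n - 1
    · by_cases h1 : T.ω n ⟨y, h⟩ b = 1
      · simp [directedFun, letterSection, h, h1, topPerm, eval_nil, rootedFun_one]
      · simp only [directedFun, letterSection, h, h1, topPerm, eval_inl, dif_pos, if_false]
        rfl
    · simp only [directedFun, letterSection, h, topPerm, eval_inr, dite_false]
      rfl

theorem eval_apply_cons (n : ℕ) (u : List (Equiv.Perm (Fin (m n)) ⊕ B)) (y : Fin (m n))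
    (w : Word m (n + 1)) :
    T.eval n u (cons y w) = cons (topPerm u y) (T.eval (n + 1) (T.wordSection n y u) w) := by
  induction u with
  | nil => rfl
  | cons l u ih =>
    rw [eval_cons, RelIso.mul_apply, ih, eval_letter_apply_cons, wordSection, eval_append]
    simp [topPerm]

theorem eval_pow_apply_cons (n : ℕ) (u : List (Equiv.Perm (Fin (m n)) ⊕ B)) (y : Fin (m n))
    (k : ℕ) (w : Word m (n + 1)) :
    (T.eval n u ^ k) (cons y w) =
      cons ((topPerm u)^[k] y) (T.eval (n + 1) (T.powSection n u y k) w) := by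
  induction k with
  | zero => rfl
  | succ k ih =>
    rw [pow_succ', RelIso.mul_apply, ih, eval_apply_cons, powSection, eval_append,
      Function.iterate_succ_apply']
    rfl

theorem pow_apply_of_apply {n : ℕ} (g : TreeAut m n) {w : Word m n} (h : g w = w) (k : ℕ) :
    (g ^ k) w = w := by
  induction k with
  | zero => rfl
  | succ k ih => rw [pow_succ', RelIso.mul_apply, ih, h]

/-- A word spells an element of finite order if, at each letter `y`, so does the section of the
power that first returns to `y`. -/
theorem isOfFinOrder_eval_of_sections (n : ℕ) (u : List (Equiv.Perm (Fin (m n)) ⊕ B))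
    (h : ∀ y, IsOfFinOrder
      (T.eval (n + 1) (T.powSection n u y (Function.minimalPeriod (topPerm u) y)))) :
    IsOfFinOrder (T.eval n u) := by
  have key : ∀ y, ∃ N, 0 < N ∧ ∀ w, (T.eval n u ^ N) (cons y w) = cons y w := by
    intro y
    obtain ⟨M, hM, hM1⟩ := isOfFinOrder_iff_pow_eq_one.mp (h y)
    have hp : 0 < Function.minimalPeriod (topPerm u) y :=
      Function.minimalPeriod_pos_of_mem_periodicPts
        (Function.Injective.mem_periodicPts (topPerm u).injective y)
    set p := Function.minimalPeriod (topPerm u) y with hpdef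
    have hper : (topPerm u)^[p] y = y := Function.iterate_minimalPeriod
    refine ⟨p * M, Nat.mul_pos hp hM, fun w => ?_⟩
    have hk : ∀ k w, ((T.eval n u ^ p) ^ k) (cons y w) =
        cons y ((T.eval (n + 1) (T.powSection n u y p) ^ k) w) := by
      intro k
      induction k with
      | zero => intro w; rfl
      | succ k ih =>
        intro w
        rw [pow_succ', RelIso.mul_apply, ih, eval_pow_apply_cons, hper, pow_succ',
          RelIso.mul_apply]
    rw [pow_mul, hk, hM1]
    rfl
  choose N hN hfix using key
  -- The alphabet is finite, so one exponent serves all first-level subtrees.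
  refine isOfFinOrder_iff_pow_eq_one.mpr ⟨∏ y, N y, Finset.prod_pos fun y _ => hN y, ?_⟩
  ext w
  cases w with
  | nil => exact pow_apply_of_apply _ (T.eval_apply_nil n u) _
  | cons y w =>
    obtain ⟨c, hc⟩ := Finset.dvd_prod_of_mem N (Finset.mem_univ y)
    rw [hc, pow_mul, pow_apply_of_apply _ (hfix y w)]
    rfl

/-! ### Counting letters in sections -/

/-- The sections of a word on the first level together have at most as much of an additive
quantity as the word itself, if this holds for single letters. -/
theorem sum_wordSection_le {M : Type*} [AddCommMonoid M] [PartialOrder M] [IsOrderedAddMonoid M]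
    (n : ℕ) (f : List (Equiv.Perm (Fin (m (n + 1))) ⊕ B) → M) (hf0 : f [] = 0)
    (hf : ∀ u v, f (u ++ v) = f u + f v) (g : Multiset B → M) (hg0 : g 0 = 0)
    (hg : ∀ b s, g (b ::ₘ s) = g {b} + g s)
    (hfg : ∀ b, ∑ y, f (T.letterSection n y (.inr b)) ≤ g {b})
    (u : List (Equiv.Perm (Fin (m n)) ⊕ B)) :
    ∑ y, f (T.wordSection n y u) ≤ g (directedLetters u) := by
  induction u with
  | nil => simp [wordSection, hf0, directedLetters, hg0]
  | cons l u ih =>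
    simp only [wordSection, hf, Finset.sum_add_distrib]
    -- The leading letter acts last, at a permuted point; summing over all points removes the
    -- permutation.
    rw [Equiv.sum_comp (topPerm u) fun y => f (T.letterSection n y l)]
    cases l with
    | inl a => simpa [letterSection, hf0, directedLetters_cons_inl] using ih
    | inr b => rw [directedLetters_cons_inr, hg]; exact add_le_add (hfg b) ih

/-- Before the first return the orbit visits distinct letters, so each section is used at most once.
-/
theorem powSection_le_sum {M : Type*} [AddCommMonoid M] [PartialOrder M] [IsOrderedAddMonoid M]
    [CanonicallyOrderedAdd M]
    (n : ℕ) (f : List (Equiv.Perm (Fin (m (n + 1))) ⊕ B) → M) (hf0 : f [] = 0)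
    (hf : ∀ u v, f (u ++ v) = f u + f v) (u : List (Equiv.Perm (Fin (m n)) ⊕ B))
    (y : Fin (m n)) :
    f (T.powSection n u y (Function.minimalPeriod (topPerm u) y)) ≤
      ∑ z, f (T.wordSection n z u) := by
  have h : ∀ k, f (T.powSection n u y k) =
      ∑ i ∈ Finset.range k, f (T.wordSection n ((topPerm u)^[i] y) u) := by
    intro k
    induction k with
    | zero => simp [powSection, hf0]
    | succ k ih => rw [powSection, hf, ih, Finset.sum_range_succ, add_comm]
  rw [h]
  have hinj : Set.InjOn (fun i => (topPerm u)^[i] y)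
      (Finset.range (Function.minimalPeriod (topPerm u) y)) := by
    intro i hi j hj hij
    exact Function.iterate_injOn_Iio_minimalPeriod (by simpa using hi) (by simpa using hj) hij
  rw [← Finset.sum_image (g := fun i => (topPerm u)^[i] y)
    (f := fun z => f (T.wordSection n z u)) hinj]
  exact Finset.sum_le_sum_of_subset (Finset.subset_univ _)

theorem sum_directedLetters_letterSection (n : ℕ) (b : B) :
    ∑ y, directedLetters (T.letterSection n y (.inr b)) = {b} := by
  have hm := T.two_le n
  have hlt : m n - 1 < m n := by omega
  rw [Finset.sum_eq_single (⟨m n - 1, hlt⟩ : Fin (m n))]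
  · simp [letterSection, directedLetters]
  · intro y _ hy
    have h : (y : ℕ) < m n - 1 := by
      have := y.2
      have : (y : ℕ) ≠ m n - 1 := fun e => hy (Fin.ext e)
      omega
    by_cases h1 : T.ω n ⟨y, h⟩ b = 1 <;> simp [letterSection, h, h1, directedLetters]
  · simp

-- Only the first letter can give a rooted section, and `letterSection` omits trivial permutations.
open Classical in
theorem sum_rootedCount_letterSection_le (hT : T.IsGG) (n : ℕ) (b : B) :
    ∑ y, rootedCount (T.letterSection n y (.inr b)) ≤
      (({b} : Multiset B).filter (· ∉ T.K n)).card := by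
  have hm := T.two_le n
  have hlt : 0 < m n := by omega
  rw [Finset.sum_eq_single (⟨0, hlt⟩ : Fin (m n))]
  · have h : 0 < m n - 1 := by omega
    by_cases h1 : T.ω n ⟨0, h⟩ b = 1
    · simp [letterSection, h, h1, rootedCount]
    · have hK : b ∉ T.K n := h1
      simp [letterSection, h, h1, rootedCount, hK, Multiset.filter_singleton]
  · intro y _ hy
    by_cases h : (y : ℕ) < m n - 1
    · have h1 : T.ω n ⟨y, h⟩ = 1 := hT.trivial_of_ne_first n _ fun e => hy (Fin.ext (by
        simpa [first] using congrArg Fin.val e))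
      simp [letterSection, h, h1, rootedCount]
    · simp [letterSection, h, rootedCount]
  · simp

/-- Comparing multisets, not just sizes, lets a chosen letter be traced down the tree: equal size
forces equal letters. -/
theorem directedLetters_powSection_le (n : ℕ) (u : List (Equiv.Perm (Fin (m n)) ⊕ B))
    (y : Fin (m n)) :
    directedLetters (T.powSection n u y (Function.minimalPeriod (topPerm u) y)) ≤
      directedLetters u :=
  (T.powSection_le_sum n directedLetters rfl directedLetters_append u y).trans
    (T.sum_wordSection_le n directedLetters rfl directedLetters_append id rfl
      (fun _ _ => rfl) (fun b => (T.sum_directedLetters_letterSection n b).le) u)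

open Classical in
theorem rootedCount_powSection_le (hT : T.IsGG) (n : ℕ) (u : List (Equiv.Perm (Fin (m n)) ⊕ B))
    (y : Fin (m n)) :
    rootedCount (T.powSection n u y (Function.minimalPeriod (topPerm u) y)) ≤
      ((directedLetters u).filter (· ∉ T.K n)).card :=
  (T.powSection_le_sum n rootedCount rfl rootedCount_append u y).trans
    (T.sum_wordSection_le n rootedCount rfl rootedCount_append
      (fun s => (s.filter (· ∉ T.K n)).card) rfl
      (fun b s => by rw [← Multiset.singleton_add, Multiset.filter_add, Multiset.card_add])
      (fun b => T.sum_rootedCount_letterSection_le hT n b) u)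

/-! ### Torsion by induction on directed letters -/

theorem isOfFinOrder_eval_of_adjacent (n : ℕ) {k : ℕ}
    (ih : ∀ v : List (Equiv.Perm (Fin (m n)) ⊕ B), (directedLetters v).card < k →
      IsOfFinOrder (T.eval n v))
    (u p q : List (Equiv.Perm (Fin (m n)) ⊕ B)) (b c : B)
    (hu : u = p ++ .inr b :: .inr c :: q) (hk : (directedLetters u).card ≤ k) :
    IsOfFinOrder (T.eval n u) := by
  have h : T.eval n u = T.eval n (p ++ .inr (b * c) :: q) := by
    simp [hu, eval, mul_assoc]
  rw [h]
  apply ih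
  simp only [hu, directedLetters_append, directedLetters_cons_inr, Multiset.card_add,
    Multiset.card_cons] at hk ⊢
  omega

theorem isOfFinOrder_eval_of_rootedCount_lt (hB : ∀ b : B, IsOfFinOrder b) (n : ℕ) {k : ℕ}
    (ih : ∀ v : List (Equiv.Perm (Fin (m n)) ⊕ B), (directedLetters v).card < k →
      IsOfFinOrder (T.eval n v))
    (u : List (Equiv.Perm (Fin (m n)) ⊕ B)) (hk : (directedLetters u).card ≤ k)
    (h : rootedCount u < (directedLetters u).card) : IsOfFinOrder (T.eval n u) := by
  rcases exists_cyclically_adjacent_inr u h with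
    ⟨b, rfl⟩ | ⟨p, b, c, q, hu⟩ | ⟨d, v, p, b, c, q, rfl, hv⟩
  · rw [eval_inr]
    exact (T.directed n).isOfFinOrder (hB b)
  · exact T.isOfFinOrder_eval_of_adjacent n ih u p q b c hu hk
  · have hfin := T.isOfFinOrder_eval_of_adjacent n ih (v ++ [.inr d]) p q b c hv (by
      rw [directedLetters_append, Multiset.card_add]
      rw [directedLetters_cons_inr, Multiset.card_cons] at hk
      exact hk)
    rw [eval_append] at hfin
    rw [eval_cons]
    have hconj := (MulAut.conj (T.eval n [.inr d])).toMonoidHom.isOfFinOrder hfin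
    simpa [mul_assoc] using hconj

theorem isOfFinOrder_eval (hT : T.IsGG) (hB : ∀ b : B, IsOfFinOrder b) (k : ℕ) :
    ∀ (n : ℕ) (u : List (Equiv.Perm (Fin (m n)) ⊕ B)), (directedLetters u).card = k →
      IsOfFinOrder (T.eval n u) := by
  classical
  induction k using Nat.strong_induction_on with
  | _ k ih =>
    have ih' : ∀ (n : ℕ) (v : List (Equiv.Perm (Fin (m n)) ⊕ B)), (directedLetters v).card < k →
        IsOfFinOrder (T.eval n v) := fun n v hv => ih _ hv n v rfl
    -- Here `d` is the number of levels left before reaching the kernel that contains `b`.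
    have step : ∀ (d n : ℕ) (u : List (Equiv.Perm (Fin (m n)) ⊕ B)),
        (directedLetters u).card = k → (∃ b ∈ directedLetters u, b ∈ T.K (n + d)) →
        IsOfFinOrder (T.eval n u) := by
      intro d
      induction d with
      | zero =>
        rintro n u hk ⟨b, hbu, hbK⟩
        refine T.isOfFinOrder_eval_of_sections n u fun y => ?_
        have hle := Multiset.card_le_card (T.directedLetters_powSection_le n u y)
        rcases hle.lt_or_eq with hlt | heq
        · exact ih' _ _ (hk ▸ hlt)
        · refine T.isOfFinOrder_eval_of_rootedCount_lt hB _ (ih' _) _ (hk ▸ hle) ?_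
          rw [heq]
          refine (T.rootedCount_powSection_le hT n u y).trans_lt (Multiset.card_lt_card ?_)
          refine lt_of_le_of_ne (Multiset.filter_le _ _) fun e => ?_
          exact Multiset.filter_eq_self.mp e b hbu hbK
      | succ d ihd =>
        rintro n u hk ⟨b, hbu, hbK⟩
        refine T.isOfFinOrder_eval_of_sections n u fun y => ?_
        have hle := T.directedLetters_powSection_le n u y
        rcases (Multiset.card_le_card hle).lt_or_eq with hlt | heq
        · exact ih' _ _ (hk ▸ hlt)
        · have hsame := Multiset.eq_of_le_of_card_le hle heq.ge
          refine ihd (n + 1) _ (heq.trans hk) ⟨b, hsame ▸ hbu, ?_⟩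
          rwa [show n + 1 + d = n + (d + 1) by omega]
    intro n u hk
    by_cases h0 : directedLetters u = 0
    · refine T.isOfFinOrder_eval_of_sections n u fun y => ?_
      have h1 := T.directedLetters_powSection_le n u y
      have h2 := T.rootedCount_powSection_le hT n u y
      rw [h0] at h1 h2
      -- Sections of purely rooted words are empty, since rooted letters also arise only from
      -- directed ones.
      have hnil : T.powSection n u y (Function.minimalPeriod (topPerm u) y) = [] := by
        generalize T.powSection n u y (Function.minimalPeriod (topPerm u) y) = v at h1 h2
        match v with
        | [] => rfl
        | .inl a :: v => simp [rootedCount_cons_inl] at h2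
        | .inr b :: v => simp [directedLetters_cons_inr] at h1
      rw [hnil, eval_nil]
      exact IsOfFinOrder.one
    · obtain ⟨b, hb⟩ := Multiset.exists_mem_of_ne_zero h0
      have hcov : b ∈ ⋃ i ≥ n, (T.K i : Set B) := by rw [hT.strong_covering n]; trivial
      simp only [Set.mem_iUnion] at hcov
      obtain ⟨i, hi, hbi⟩ := hcov
      exact step (i - n) n u hk ⟨b, hb, by rwa [Nat.add_sub_cancel' hi]⟩

/-! ### Spelling group elements and embedding `B` -/

theorem exists_eval_eq (n : ℕ) {g : TreeAut m n} (hg : g ∈ T.shiftedGroup n) :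
    ∃ u, T.eval n u = g := by
  induction hg using Subgroup.closure_induction with
  | mem g hg =>
    rcases hg with ⟨a, -, rfl⟩ | ⟨b, rfl⟩
    · exact ⟨[.inl a], T.eval_inl n a⟩
    · exact ⟨[.inr b], T.eval_inr n b⟩
  | one => exact ⟨[], rfl⟩
  | mul g h _ _ ihg ihh =>
    obtain ⟨u, rfl⟩ := ihg
    obtain ⟨v, rfl⟩ := ihh
    exact ⟨u ++ v, T.eval_append n u v⟩
  | inv g _ ih =>
    obtain ⟨u, rfl⟩ := ih
    refine ⟨(u.map (Sum.map (·⁻¹) (·⁻¹))).reverse, ?_⟩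
    rw [eval, eval, List.prod_inv_reverse, List.map_reverse, List.map_map, List.map_map]
    congr 3
    ext l : 1
    cases l <;> simp

/-- Going down along last letters, sections of a trivial automorphism stay trivial, and so do the
rooted sections beside that ray. -/
theorem omega_eq_one_of_directed_eq_one {b : B} {r : ℕ} (h : T.directed r b = 1) (d : ℕ)
    (j : Fin (m (r + d) - 1)) : T.ω (r + d) j b = 1 := by
  induction d generalizing r with
  | zero =>
    ext z : 1
    have hj : (j : ℕ) < m r - 1 := j.2
    have := DFunLike.congr_fun h (cons ⟨j, by omega⟩ (cons z nil))
    change T.directedFun b _ = _ at this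
    simpa [directedFun, rootedFun] using this
  | succ d ih =>
    have hm := T.two_le r
    have h' : T.directed (r + 1) b = 1 := by
      ext w
      have := DFunLike.congr_fun h (cons ⟨m r - 1, by omega⟩ w)
      change T.directedFun b _ = _ at this
      change T.directedFun b w = w
      simpa [directedFun] using this
    have e : r + (d + 1) = r + 1 + d := by omega
    revert j
    rw [e]
    exact fun j => ih h' j

theorem directed_injective (hT : T.IsSpinal) (r : ℕ) : Function.Injective (T.directed r) := by
  rw [injective_iff_map_eq_one]
  intro b hb
  have hmem : b ∈ ⨅ n ≥ r, ⨅ j : Fin (m n - 1), (T.ω n j).ker := by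
    simp only [Subgroup.mem_iInf, MonoidHom.mem_ker]
    intro n hn
    obtain ⟨d, rfl⟩ := Nat.exists_eq_add_of_le hn
    exact T.omega_eq_one_of_directed_eq_one hb d
  rwa [hT.kernel_intersection r, Subgroup.mem_bot] at hmem

end DefiningTriple

theorem mainTheorem2 {m : ℕ → ℕ} {B : Type*} [Group B] (T : DefiningTriple m B)
    (hT : T.IsGG) : IsMulTorsion T.G ↔ IsMulTorsion B := by
  constructor
  · intro hG b
    have hmem : T.directed 0 b ∈ T.G := Subgroup.subset_closure (.inr ⟨b, rfl⟩)
    have h := T.G.subtype.isOfFinOrder (hG ⟨_, hmem⟩)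
    exact (T.directed_injective hT.toIsSpinal 0).isOfFinOrder_iff.mp h
  · rintro hB ⟨g, hg⟩
    obtain ⟨u, rfl⟩ := T.exists_eval_eq 0 hg
    exact Submonoid.isOfFinOrder_coe.mp (T.isOfFinOrder_eval hT hB _ 0 u rfl)
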